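/- Consider a bandit with $k\ge 1$ arms. In round $t=1,2,\dots$ arm $i$, if pulled, yields a reward $X_{i,t}\sim\mathcal N(\mu_i,\sigma_i^2)$ with $\sigma_i>0$ known; the $X_{i,t}$ are independent across arms and rounds, and there is a unique best arm $b$, i.e. $\mu_b>\mu_i$ for all $i\ne b$. Start from the non-informative normal prior $\theta_{i,1}=0$, $\lambda_{i,1}^2=\infty$ for every arm; when arm $i$ is pulled in round $t$, update $$\theta_{i,t+1}=\frac{\lambda_{i,t}^{-2}\theta_{i,t}+\sigma_i^{-2}X_{i,t}}{\lambda_{i,t}^{-2}+\sigma_i^{-2}},\qquad \lambda_{i,t+1}^2=\left(\lambda_{i,t}^{-2}+\sigma_i^{-2}\right)^{-1}$$ (with $\infty^{-1}=0$), leaving the other arms unchanged. The knowledge gradient (KG) algorithm pulls in round $t$ an arm $I_t$ that maximizes $$v_{i,t}=\zeta_{i,t}\,f\!\left(-\frac{|\theta_{i,t}-\max_{j\ne i}\theta_{j,t}|}{\zeta_{i,t}}\right),\qquad \zeta_{i,t}^2=\lambda_{i,t}^2-\left(\lambda_{i,t}^{-2}+\sigma_i^{-2}\right)^{-1},\qquad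 f(x)=x\Phi(x)+\phi(x),$$ where $\Phi,\phi$ are the standard normal distribution function and density, $v_{i,t}=\infty$ if $\zeta_{i,t}=\infty$ (arm $i$ not pulled yet), and ties are broken in any non-anticipating way. (For $k=1$ the only arm is always pulled.) Let $N_{i,t}=\sum_{s=1}^t\mathbf 1\{I_s=i\}$ and $\hat\mu_{i,t}=\frac1{N_{i,t}}\sum_{s=1}^t\mathbf 1\{I_s=i\}X_{i,s}$. Then there is a random variable $T_0$ with values in $\mathbb N$ such that, almost surely, $$N_{i,t}\ge\left(\frac tk\right)^{3/4}\qquad\text{for all } t\ge T_0 \text{ and all } i\in\{1,\dots,k\}.$$ Consequently KG is consistent: almost surely $\hat\mu_{i,t}\to\mu_i$ and $\theta_{i,t}\to\mu_i$ as $t\to\infty$ for every arm $i$, and for all sufficiently large $t$ every maximizer of $i\mapsto\theta_{i,t}$ equals $b$. -/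

import Mathlib

open MeasureTheory ProbabilityTheory Filter Topology
open scoped ENNReal NNReal

noncomputable section

namespace KnowledgeGradient

/-- The function `f(x) = x Φ(x) + φ(x)`, with `Φ` and `φ` the cumulative distribution function
and the density of the standard normal law. -/
def kgFun (x : ℝ) : ℝ := x * cdf (gaussianReal 0 1) x + gaussianPDFReal 0 1 x

/-- A state of knowledge: for every arm `i` the mean `θ i` and the variance `λ² i` of the normal
posterior. The variance may be `∞` (non-informative prior). -/
structure Knowledge (k : ℕ) where
  /-- posterior means -/
  mean : Fin k → ℝ
  /-- posterior variances -/
  var : Fin k → ℝ≥0∞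

/-- The non-informative prior: mean `0` and variance `∞` for every arm. -/
def initialKnowledge (k : ℕ) : Knowledge k where
  mean := fun _ => 0
  var := fun _ => ∞

/-- The posterior variance `(λ⁻² + σ⁻²)⁻¹` after one more reward with standard deviation `s`,
where `v = λ²` and `∞⁻¹ = 0`. -/
def nextVar (s : ℝ) (v : ℝ≥0∞) : ℝ≥0∞ := (v⁻¹ + (ENNReal.ofReal (s ^ 2))⁻¹)⁻¹

/-- The posterior mean `(λ⁻² θ + σ⁻² x) / (λ⁻² + σ⁻²)` after one more reward `x`. -/
def nextMean (s m : ℝ) (v : ℝ≥0∞) (x : ℝ) : ℝ :=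
  (v⁻¹.toReal * m + (s ^ 2)⁻¹ * x) / (v⁻¹.toReal + (s ^ 2)⁻¹)

/-- The knowledge after the reward `x` of arm `i` has been observed. -/
def Knowledge.observe {k : ℕ} (σ : Fin k → ℝ) (S : Knowledge k) (i : Fin k) (x : ℝ) :
    Knowledge k where
  mean := Function.update S.mean i (nextMean (σ i) (S.mean i) (S.var i) x)
  var := Function.update S.var i (nextVar (σ i) (S.var i))

/-- The standard deviation `ζ` of the change of the posterior mean of arm `i` if it is pulled
next: `ζ²` is the decrease of its posterior variance. It is `∞` for an arm not pulled so far. -/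
def Knowledge.zeta {k : ℕ} (σ : Fin k → ℝ) (S : Knowledge k) (i : Fin k) : ℝ≥0∞ :=
  (S.var i - nextVar (σ i) (S.var i)) ^ (1 / 2 : ℝ)

/-- The knowledge gradient `ζ_i f(-|θ_i - max_{j ≠ i} θ_j| / ζ_i)` of arm `i`, computed in
`[0, ∞]`: it is `∞` exactly when `ζ_i = ∞`, that is, for an arm not pulled so far. -/
def Knowledge.kgValue {k : ℕ} (σ : Fin k → ℝ) (S : Knowledge k) (i : Fin k) : ℝ≥0∞ :=
  S.zeta σ i * ENNReal.ofReal
    (kgFun (-(ENNReal.ofReal |S.mean i - ⨆ j : {j : Fin k // j ≠ i}, S.mean j|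
      / S.zeta σ i).toReal))

/-- The knowledge after the first `t` rounds, when arm `a s` is pulled in the `s`-th round and
its reward is `x (a s) s`. Rounds are numbered `0, 1, 2, …`. -/
def knowledgeAfter {k : ℕ} (σ : Fin k → ℝ) (x : Fin k → ℕ → ℝ) (a : ℕ → Fin k) :
    ℕ → Knowledge k
  | 0 => initialKnowledge k
  | t + 1 => (knowledgeAfter σ x a t).observe σ (a t) (x (a t) t)

/-- The number of pulls of arm `i` during the first `t` rounds. -/
def numPulls {k : ℕ} (a : ℕ → Fin k) (i : Fin k) (t : ℕ) : ℕ :=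
  ((Finset.range t).filter (fun s => a s = i)).card

/-- The average of the rewards of arm `i` observed during the first `t` rounds. -/
def sampleMean {k : ℕ} (x : Fin k → ℕ → ℝ) (a : ℕ → Fin k) (i : Fin k) (t : ℕ) : ℝ :=
  (∑ s ∈ Finset.range t, if a s = i then x i s else 0) / numPulls a i t

/-- `X i t` is the reward that arm `i` yields if it is pulled in round `t`: independent across
arms and rounds, with law `N(μ i, (σ i)²)`. -/
structure IsGaussianBandit {Ω : Type*} [MeasurableSpace Ω] (P : Measure Ω) {k : ℕ}
    (μ σ : Fin k → ℝ) (X : Fin k → ℕ → Ω → ℝ) : Prop where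
  measurable : ∀ i t, Measurable (X i t)
  law : ∀ i t, P.map (X i t) = gaussianReal (μ i) (σ i ^ 2).toNNReal
  indep : iIndepFun (fun (p : Fin k × ℕ) => X p.1 p.2) P

/-- `I t` is the arm pulled in round `t` by the knowledge gradient algorithm: it maximizes the
knowledge gradient in the current state of knowledge. Ties are broken in any non-anticipating
way: `ℱ t` is what may be known before round `t`, that is, all rewards of earlier rounds and
possibly auxiliary randomization, and the rewards of round `t` are independent of it. -/
structure IsKGRun {Ω : Type*} [m : MeasurableSpace Ω] (P : Measure Ω) {k : ℕ}
    (σ : Fin k → ℝ) (X : Fin k → ℕ → Ω → ℝ) (ℱ : Filtration ℕ m) (I : ℕ → Ω → Fin k) : Prop where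
  choice_measurable : ∀ t, Measurable[ℱ t] (I t)
  reward_measurable : ∀ i t, Measurable[ℱ (t + 1)] (X i t)
  reward_indep : ∀ t,
    Indep (MeasurableSpace.comap (fun ω i => X i t ω) MeasurableSpace.pi) (ℱ t) P
  maximizes : ∀ t ω i,
    (knowledgeAfter σ (fun j s => X j s ω) (fun s => I s ω) t).kgValue σ i ≤
      (knowledgeAfter σ (fun j s => X j s ω) (fun s => I s ω) t).kgValue σ (I t ω)

end KnowledgeGradient

end

/-!
Everything is deduced, outcome by outcome, from one almost sure fact: for every arm `i` the sum
`∑ (X_{i,s} - μ_i) / n`, taken over the rounds `s` in which arm `i` is pulled for the `n`-th time,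
converges. Its partial sums form a martingale which is bounded in `L²` because `∑ 1 / n² < ∞`
(`ae_exists_tendsto_sum_mul`, `ae_exists_tendsto_sum_pullWeight`). Summation by parts and Cesàro
averaging along the pulls turn this into two statements about the sample means, which coincide
with the posterior means: they are always bounded (`exists_abs_sampleMean_le`), and they converge
to `μ_i` if arm `i` is pulled infinitely often (`tendsto_sampleMean`).

About `f` only positivity and strict monotonicity are needed; both follow from
`f(x) = 𝔼[(x - Z)⁺]` (`kgFun_pos`, `kgFun_strictMono`). After `n ≥ 1` pulls
`ζ_i = σ_i / √(n (n + 1))`.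

* Every arm is pulled infinitely often (`tendsto_numPulls`). The knowledge gradient of an arm
  pulled infinitely often is at most `ζ f(0) → 0`, while that of an arm pulled finitely often is
  infinite or bounded below, since the gaps `Δ_i = |θ_i - max_{j ≠ i} θ_j|` are bounded.
* Hence all posterior means converge, and as the best arm is unique the gaps are, for
  `k ≥ 2`, eventually bounded away from zero (`exists_eventually_lead`, `Knowledge.le_gap`).
* Let arm `j` be pulled although its pull count far exceeds that of arm `i`. Then `ζ_j ≤ ζ_i`, so
  `v_i ≤ v_j` and monotonicity of `f` give `Δ_j / ζ_j ≤ Δ_i / ζ_i`. As `1 / ζ` is comparable to the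
  pull count, the pull count of `j` is at most a constant times that of `i`
  (`exists_numPulls_le_of_pull`). So all pull counts are comparable, grow linearly and eventually
  exceed `(t / k) ^ (3 / 4)` (`eventually_le_numPulls`).
-/

namespace KnowledgeGradient

/-! ### The function `f(x) = x Φ(x) + φ(x)` -/

lemma gaussianPDFReal_zero_one (x : ℝ) :
    gaussianPDFReal 0 1 x = (√(2 * Real.pi))⁻¹ * Real.exp (-x ^ 2 / 2) := by
  simp [gaussianPDFReal]

lemma hasDerivAt_gaussianPDFReal_zero_one (x : ℝ) :
    HasDerivAt (gaussianPDFReal 0 1) (-(x * gaussianPDFReal 0 1 x)) x := by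
  have h : HasDerivAt (fun y : ℝ => (√(2 * Real.pi))⁻¹ * Real.exp (-y ^ 2 / 2))
      ((√(2 * Real.pi))⁻¹ * (Real.exp (-x ^ 2 / 2) * (-(2 * x) / 2))) x := by
    refine (HasDerivAt.exp ?_).const_mul _
    simpa using ((hasDerivAt_pow 2 x).neg.div_const 2)
  rw [show gaussianPDFReal 0 1 = fun y : ℝ => (√(2 * Real.pi))⁻¹ * Real.exp (-y ^ 2 / 2) from
    funext gaussianPDFReal_zero_one]
  convert h using 1
  ring

lemma tendsto_gaussianPDFReal_zero_one_atBot :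
    Tendsto (gaussianPDFReal 0 1) atBot (𝓝 0) := by
  rw [show gaussianPDFReal 0 1 = fun y : ℝ => (√(2 * Real.pi))⁻¹ * Real.exp (-y ^ 2 / 2) from
    funext gaussianPDFReal_zero_one]
  have h : Tendsto (fun y : ℝ => -y ^ 2 / 2) atBot atBot := by
    have h2 : Tendsto (fun y : ℝ => y ^ 2) atBot atTop := by
      simpa [Function.comp_def, sq_abs] using
        (tendsto_pow_atTop (α := ℝ) two_ne_zero).comp tendsto_abs_atBot_atTop
    exact (tendsto_neg_atTop_atBot.comp h2).atBot_div_const two_pos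
  simpa using (Real.tendsto_exp_atBot.comp h).const_mul (√(2 * Real.pi))⁻¹

lemma integrable_id_mul_gaussianPDFReal :
    Integrable (fun z : ℝ => z * gaussianPDFReal 0 1 z) := by
  have h := (integrable_mul_exp_neg_mul_sq (b := 1 / 2) (by norm_num)).const_mul
    (√(2 * Real.pi))⁻¹
  refine h.congr (ae_of_all _ fun z => ?_)
  simp only [gaussianPDFReal_zero_one]
  rw [show -(1 / 2) * z ^ 2 = -z ^ 2 / 2 by ring]
  ring

lemma cdf_gaussianReal_eq_integral (x : ℝ) :
    cdf (gaussianReal 0 1) x = ∫ z in Set.Iic x, gaussianPDFReal 0 1 z := by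
  rw [cdf_eq_real, measureReal_def, gaussianReal_apply_eq_integral 0 one_ne_zero,
    ENNReal.toReal_ofReal (integral_nonneg fun z => gaussianPDFReal_nonneg _ _ _)]

lemma cdf_gaussianReal_pos (x : ℝ) : 0 < cdf (gaussianReal 0 1) x := by
  rw [cdf_gaussianReal_eq_integral, setIntegral_pos_iff_support_of_nonneg_ae
    (ae_of_all _ fun z => gaussianPDFReal_nonneg _ _ _)
    (integrable_gaussianPDFReal 0 1).integrableOn]
  have : Function.support (gaussianPDFReal 0 1) = Set.univ :=
    Set.eq_univ_of_forall fun z => (gaussianPDFReal_pos 0 1 z one_ne_zero).ne'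
  simp [this]

/-- `f(x) = 𝔼[(x - Z)⁺]` for a standard normal `Z`. -/
lemma kgFun_eq_integral (x : ℝ) :
    kgFun x = ∫ z in Set.Iic x, (x - z) * gaussianPDFReal 0 1 z := by
  have h1 : ∫ z in Set.Iic x, z * gaussianPDFReal 0 1 z = -gaussianPDFReal 0 1 x := by
    have h := integral_Iic_of_hasDerivAt_of_tendsto' (a := x)
      (fun z _ => hasDerivAt_gaussianPDFReal_zero_one z)
      integrable_id_mul_gaussianPDFReal.neg.integrableOn tendsto_gaussianPDFReal_zero_one_atBot
    rw [integral_neg] at h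
    linarith
  simp_rw [sub_mul]
  rw [integral_sub ((integrable_gaussianPDFReal 0 1).const_mul x).integrableOn
    integrable_id_mul_gaussianPDFReal.integrableOn, integral_const_mul, h1,
    ← cdf_gaussianReal_eq_integral, kgFun]
  ring

lemma kgFun_nonneg (x : ℝ) : 0 ≤ kgFun x := by
  rw [kgFun_eq_integral]
  refine setIntegral_nonneg measurableSet_Iic fun z hz => ?_
  exact mul_nonneg (sub_nonneg.2 hz) (gaussianPDFReal_nonneg _ _ _)

lemma kgFun_strictMono : StrictMono kgFun := by
  intro x y hxy
  have hint (u v : ℝ) :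
      IntegrableOn (fun z => (u - z) * gaussianPDFReal 0 1 z) (Set.Iic v) := by
    simp_rw [sub_mul]
    exact (((integrable_gaussianPDFReal 0 1).const_mul u).sub
      integrable_id_mul_gaussianPDFReal).integrableOn
  have h1 : ∫ z in Set.Iic x, (y - z) * gaussianPDFReal 0 1 z ≤ kgFun y := by
    rw [kgFun_eq_integral]
    refine setIntegral_mono_set (hint y y) ?_ (Set.Iic_subset_Iic.2 hxy.le).eventuallyLE
    filter_upwards [ae_restrict_mem measurableSet_Iic] with z hz
    exact mul_nonneg (sub_nonneg.2 hz) (gaussianPDFReal_nonneg _ _ _)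
  have h2 : ∫ z in Set.Iic x, (y - z) * gaussianPDFReal 0 1 z
      = kgFun x + (y - x) * cdf (gaussianReal 0 1) x := by
    rw [kgFun_eq_integral, cdf_gaussianReal_eq_integral, ← integral_const_mul,
      ← integral_add (hint x x) ((integrable_gaussianPDFReal 0 1).const_mul _).integrableOn]
    congr with z
    ring
  have h3 := mul_pos (sub_pos.2 hxy) (cdf_gaussianReal_pos x)
  linarith

lemma kgFun_pos (x : ℝ) : 0 < kgFun x :=
  (kgFun_nonneg (x - 1)).trans_lt (kgFun_strictMono (sub_one_lt x))

/-! ### The posterior in terms of pull counts and sample means -/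

section Posterior

variable {k : ℕ} {σ : Fin k → ℝ} {x : Fin k → ℕ → ℝ} {a : ℕ → Fin k}

@[simp] lemma numPulls_zero (i : Fin k) : numPulls a i 0 = 0 := by simp [numPulls]

lemma numPulls_succ (i : Fin k) (t : ℕ) :
    numPulls a i (t + 1) = numPulls a i t + if a t = i then 1 else 0 := by
  simp only [numPulls, Finset.card_filter, Finset.sum_range_succ]

lemma numPulls_mono (i : Fin k) : Monotone (numPulls a i) :=
  monotone_nat_of_le_succ fun t => by rw [numPulls_succ]; exact Nat.le_add_right _ _

lemma sum_numPulls (t : ℕ) : ∑ i, numPulls a i t = t := by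
  induction t with
  | zero => simp
  | succ t ih => simp [numPulls_succ, Finset.sum_add_distrib, ih]

lemma inv_var_knowledgeAfter (i : Fin k) (t : ℕ) :
    ((knowledgeAfter σ x a t).var i)⁻¹ = numPulls a i t * (ENNReal.ofReal (σ i ^ 2))⁻¹ := by
  induction t with
  | zero => simp [knowledgeAfter, initialKnowledge]
  | succ t ih =>
    by_cases h : a t = i
    · subst h
      simp [knowledgeAfter, Knowledge.observe, numPulls_succ, nextVar, ih, add_mul]
    · simp [knowledgeAfter, Knowledge.observe, numPulls_succ, ih, h, Ne.symm h]

lemma numPulls_mul_mean (hσ : ∀ i, 0 < σ i) (i : Fin k) (t : ℕ) :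
    numPulls a i t * (knowledgeAfter σ x a t).mean i
      = ∑ s ∈ Finset.range t, if a s = i then x i s else 0 := by
  induction t with
  | zero => simp
  | succ t ih =>
    rw [Finset.sum_range_succ, ← ih]
    by_cases h : a t = i
    · subst h
      have hσ0 := (hσ (a t)).ne'
      have hN : (numPulls a (a t) t : ℝ) + 1 ≠ 0 := by positivity
      simp only [knowledgeAfter, Knowledge.observe, numPulls_succ, nextMean,
        inv_var_knowledgeAfter, Function.update_self, if_true, ENNReal.toReal_mul,
        ENNReal.toReal_natCast, ENNReal.toReal_inv, ENNReal.toReal_ofReal (sq_nonneg _)]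
      push_cast
      field_simp
    · simp [knowledgeAfter, Knowledge.observe, numPulls_succ, h, Ne.symm h]

lemma mean_eq_zero_of_numPulls_eq_zero (i : Fin k) (t : ℕ) (h : numPulls a i t = 0) :
    (knowledgeAfter σ x a t).mean i = 0 := by
  induction t with
  | zero => rfl
  | succ t ih =>
    rw [numPulls_succ, Nat.add_eq_zero_iff] at h
    have hi : a t ≠ i := fun hi => by simp [hi] at h
    simpa [knowledgeAfter, Knowledge.observe, hi.symm] using ih h.1

lemma mean_eq_sampleMean (hσ : ∀ i, 0 < σ i) (i : Fin k) (t : ℕ) :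
    (knowledgeAfter σ x a t).mean i = sampleMean x a i t := by
  rcases eq_or_ne (numPulls a i t) 0 with h | h
  · rw [mean_eq_zero_of_numPulls_eq_zero i t h]
    simp [sampleMean, h]
  · rw [sampleMean, ← numPulls_mul_mean hσ, mul_div_cancel_left₀]
    exact_mod_cast h

lemma zeta_eq (hσ : ∀ i, 0 < σ i) {i : Fin k} {t : ℕ} (h : 0 < numPulls a i t) :
    (knowledgeAfter σ x a t).zeta σ i
      = ENNReal.ofReal (σ i / √(numPulls a i t * (numPulls a i t + 1))) := by
  have hs : 0 < σ i ^ 2 := pow_pos (hσ i) 2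
  have hinv (n : ℕ) (hn : 0 < n) :
      ((n : ℝ≥0∞) * (ENNReal.ofReal (σ i ^ 2))⁻¹)⁻¹ = ENNReal.ofReal (σ i ^ 2 / n) := by
    have hn' : (0 : ℝ) < n := by exact_mod_cast hn
    rw [← ENNReal.ofReal_inv_of_pos hs, ← ENNReal.ofReal_natCast,
      ← ENNReal.ofReal_mul hn'.le, ← ENNReal.ofReal_inv_of_pos (by positivity)]
    congr 1
    field_simp
  have hv : (knowledgeAfter σ x a t).var i = ENNReal.ofReal (σ i ^ 2 / numPulls a i t) := by
    rw [← hinv _ h, ← inv_var_knowledgeAfter, inv_inv]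
  have hv' : nextVar (σ i) ((knowledgeAfter σ x a t).var i)
      = ENNReal.ofReal (σ i ^ 2 / (numPulls a i t + 1 : ℕ)) := by
    rw [nextVar, inv_var_knowledgeAfter, ← hinv _ (Nat.succ_pos _)]
    push_cast
    rw [add_mul, one_mul]
  have hn' : (0 : ℝ) < numPulls a i t := by exact_mod_cast h
  rw [Knowledge.zeta, hv', hv, ← ENNReal.ofReal_sub _ (by positivity),
    ENNReal.ofReal_rpow_of_nonneg _ (by norm_num), ← Real.sqrt_eq_rpow]
  · congr 1
    rw [← Real.sqrt_sq (hσ i).le, ← Real.sqrt_div (by positivity), Real.sqrt_sq (hσ i).le]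
    congr 1
    push_cast
    field_simp
    ring
  · rw [sub_nonneg]
    gcongr
    simp

/-- The distance of the posterior mean of arm `i` from the best of the other posterior means. -/
noncomputable def Knowledge.gap (S : Knowledge k) (i : Fin k) : ℝ :=
  |S.mean i - ⨆ j : {j : Fin k // j ≠ i}, S.mean j|

lemma kgValue_eq (hσ : ∀ i, 0 < σ i) {i : Fin k} {t : ℕ} (h : 0 < numPulls a i t) {z : ℝ}
    (hz : z = σ i / √(numPulls a i t * (numPulls a i t + 1))) :
    (knowledgeAfter σ x a t).kgValue σ i
      = ENNReal.ofReal (z * kgFun (-((knowledgeAfter σ x a t).gap i / z))) := by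
  have hn' : (0 : ℝ) < numPulls a i t := by exact_mod_cast h
  have hz0 : 0 < z := hz ▸ div_pos (hσ i) (Real.sqrt_pos.2 (by positivity))
  rw [Knowledge.kgValue, zeta_eq hσ h, ← hz, ENNReal.ofReal_mul hz0.le,
    ← ENNReal.ofReal_div_of_pos hz0, ENNReal.toReal_ofReal (by positivity)]
  rfl

lemma kgValue_eq_top {i : Fin k} {t : ℕ} (h : numPulls a i t = 0) :
    (knowledgeAfter σ x a t).kgValue σ i = ∞ := by
  have hv : (knowledgeAfter σ x a t).var i = ∞ := by
    rw [← inv_inv ((knowledgeAfter σ x a t).var i), inv_var_knowledgeAfter, h]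
    simp
  have hz : (knowledgeAfter σ x a t).zeta σ i = ∞ := by
    simp [Knowledge.zeta, hv, nextVar]
  rw [Knowledge.kgValue, hz, ENNReal.top_mul]
  simpa using kgFun_pos _

end Posterior

/-! ### Almost sure convergence of weighted sums of innovations -/

/-- A sum `∑ w s * d s` of independent centred innovations `d s` with predictable bounded weights
converges almost surely if the squared weights are summable with a deterministic bound: its
partial sums form a martingale bounded in `L²`. -/
lemma ae_exists_tendsto_sum_mul {Ω : Type*} [m : MeasurableSpace Ω] {P : Measure Ω}
    [IsProbabilityMeasure P] {ℱ : Filtration ℕ m} {d w : ℕ → Ω → ℝ} {V C : ℝ}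
    (hd : ∀ t, Measurable[ℱ (t + 1)] (d t)) (hw : ∀ t, Measurable[ℱ t] (w t))
    (hind : ∀ t, Indep (MeasurableSpace.comap (d t) inferInstance) (ℱ t) P)
    (hL2 : ∀ t, MemLp (d t) 2 P) (hmean : ∀ t, ∫ ω, d t ω ∂P = 0)
    (hvar : ∀ t, ∫ ω, d t ω ^ 2 ∂P = V) (hwb : ∀ t ω, |w t ω| ≤ 1)
    (hwC : ∀ t ω, ∑ s ∈ Finset.range t, w s ω ^ 2 ≤ C) :
    ∀ᵐ ω ∂P, ∃ l, Tendsto (fun t => ∑ s ∈ Finset.range t, w s ω * d s ω) atTop (𝓝 l) := by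
  have hV : 0 ≤ V := hvar 0 ▸ integral_nonneg fun ω => sq_nonneg _
  have hwm (t) : Measurable (w t) := (hw t).mono (ℱ.le t) le_rfl
  set Y : ℕ → Ω → ℝ := fun t ω => ∑ s ∈ Finset.range t, w s ω * d s ω with hY
  have hYs (t) : Y (t + 1) = Y t + w t * d t := by
    ext ω; simp [hY, Finset.sum_range_succ]
  have hwd (t) : MemLp (w t * d t) 2 P := by
    refine (hL2 t).mul (p := ∞) (q := 2) (r := 2) ?_
    exact memLp_top_of_bound (hwm t).aestronglyMeasurable 1 (ae_of_all _ fun ω => hwb t ω)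
  have hYL2 (t) : MemLp (Y t) 2 P := by
    induction t with
    | zero => simp [hY]
    | succ t ih => rw [hYs]; exact ih.add (hwd t)
  have hYm (t) : Measurable[ℱ t] (Y t) := by
    refine Finset.measurable_fun_sum _ fun s hs => ?_
    have hst : s < t := Finset.mem_range.1 hs
    exact ((hw s).mono (ℱ.mono hst.le) le_rfl).mul ((hd s).mono (ℱ.mono hst) le_rfl)
  have hmart : Martingale Y ℱ P := by
    refine martingale_nat (fun t => (hYm t).stronglyMeasurable)
      (fun t => (hYL2 t).integrable one_le_two) fun t => ?_
    have h1 : P[w t * d t | ℱ t] =ᵐ[P] 0 := by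
      have h2 := condExp_mul_of_stronglyMeasurable_left (μ := P) (hw t).stronglyMeasurable
        ((hwd t).integrable one_le_two) ((hL2 t).integrable one_le_two)
      have h3 := condExp_indep_eq (μ := P) (f := d t)
        (((hd t).mono (ℱ.le _) le_rfl).comap_le) (ℱ.le t)
        (comap_measurable (d t)).stronglyMeasurable (hind t)
      filter_upwards [h2, h3] with ω h2 h3
      simp [h2, h3, hmean]
    have h4 : P[Y t | ℱ t] = Y t := condExp_of_stronglyMeasurable (ℱ.le t)
      (hYm t).stronglyMeasurable ((hYL2 t).integrable one_le_two)
    rw [hYs]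
    filter_upwards [condExp_add ((hYL2 t).integrable one_le_two)
      ((hwd t).integrable one_le_two) (ℱ t), h1] with ω h h1
    rw [h, h4]
    simp [h1]
  -- both `w² · d²` and the cross term `(Y w) · d` factor by independence from the past
  have hfac (t) (g : Ω → ℝ) (hg : Measurable[ℱ t] g) (φ : ℝ → ℝ) (hφ : Measurable φ) :
      ∫ ω, g ω * φ (d t ω) ∂P = (∫ ω, g ω ∂P) * ∫ ω, φ (d t ω) ∂P := by
    have hi : IndepFun g (fun ω => φ (d t ω)) P := by
      rw [IndepFun_iff_Indep]
      refine (indep_of_indep_of_le_right (indep_of_indep_of_le_left (hind t) ?_)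
        hg.comap_le).symm
      exact (hφ.comp (comap_measurable (d t))).comap_le
    refine hi.integral_fun_mul_eq_mul_integral
      (hg.mono (ℱ.le t) le_rfl).aestronglyMeasurable ?_
    exact (hφ.comp ((hd t).mono (ℱ.le _) le_rfl)).aestronglyMeasurable
  have hsq (t) : ∫ ω, Y t ω ^ 2 ∂P = ∫ ω, (∑ s ∈ Finset.range t, w s ω ^ 2) * V ∂P := by
    have hw2 (s) : Integrable (fun ω => w s ω ^ 2) P :=
      .of_bound ((hwm s).pow_const 2).aestronglyMeasurable 1 (ae_of_all _ fun ω => by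
        simpa using hwb s ω)
    induction t with
    | zero => simp [hY]
    | succ t ih =>
      have e (ω) : Y (t + 1) ω ^ 2
          = Y t ω ^ 2 + 2 * ((Y t ω * w t ω) * d t ω) + w t ω ^ 2 * d t ω ^ 2 := by
        simp only [hYs, Pi.add_apply, Pi.mul_apply]; ring
      have i1 : Integrable (fun ω => Y t ω ^ 2) P := (hYL2 t).integrable_sq
      have i2 : Integrable (fun ω => 2 * ((Y t ω * w t ω) * d t ω)) P := by
        refine (((hYL2 t).integrable_mul (hwd t)).congr (ae_of_all _ fun ω => ?_)).const_mul 2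
        simp only [Pi.mul_apply]; ring
      have i3 : Integrable (fun ω => w t ω ^ 2 * d t ω ^ 2) P := by
        refine (hwd t).integrable_sq.congr (ae_of_all _ fun ω => ?_)
        simp only [Pi.mul_apply]; ring
      have i12 : Integrable (fun ω => Y t ω ^ 2 + 2 * ((Y t ω * w t ω) * d t ω)) P := i1.add i2
      have f2 : ∫ ω, (Y t ω * w t ω) * d t ω ∂P = 0 := by
        have := hfac t (fun ω => Y t ω * w t ω) ((hYm t).mul (hw t)) id measurable_id
        simpa [hmean] using this
      have f3 : ∫ ω, w t ω ^ 2 * d t ω ^ 2 ∂P = ∫ ω, w t ω ^ 2 * V ∂P := by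
        have := hfac t (fun ω => w t ω ^ 2) ((hw t).pow_const 2) (· ^ 2)
          (measurable_id.pow_const 2)
        simpa [hvar, integral_mul_const] using this
      simp_rw [e, Finset.sum_range_succ, add_mul]
      rw [integral_add i12 i3, integral_add i1 i2, ih, integral_const_mul, f2, f3,
        integral_add ((integrable_finsetSum _ fun s _ => hw2 s).mul_const V)
          ((hw2 t).mul_const V)]
      ring
  have hbdd (t) : eLpNorm (Y t) 1 P ≤ (1 + C * V).toNNReal := by
    rw [eLpNorm_one_eq_lintegral_enorm,
      ← ofReal_integral_norm_eq_lintegral_enorm ((hYL2 t).integrable one_le_two)]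
    refine ENNReal.ofReal_le_ofReal ?_
    calc ∫ ω, ‖Y t ω‖ ∂P ≤ ∫ ω, (1 + Y t ω ^ 2) ∂P := by
          refine integral_mono ((hYL2 t).integrable one_le_two).norm
            ((integrable_const _).add (hYL2 t).integrable_sq) fun ω => ?_
          have := sq_abs (Y t ω)
          rw [Real.norm_eq_abs]
          nlinarith [sq_nonneg (|Y t ω| - 1), abs_nonneg (Y t ω)]
      _ = 1 + ∫ ω, (∑ s ∈ Finset.range t, w s ω ^ 2) * V ∂P := by
          rw [integral_add (integrable_const _) (hYL2 t).integrable_sq, hsq]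
          simp
      _ ≤ 1 + ∫ _ω, C * V ∂P := by
          refine add_le_add le_rfl ?_
          refine integral_mono_of_nonneg (ae_of_all _ fun ω => ?_) (integrable_const _)
            (ae_of_all _ fun ω => mul_le_mul_of_nonneg_right (hwC t ω) hV)
          exact mul_nonneg (Finset.sum_nonneg fun s _ => sq_nonneg _) hV
      _ = 1 + C * V := by simp
  filter_upwards [hmart.submartingale.ae_tendsto_limitProcess hbdd] with ω h
  exact ⟨_, h⟩

/-! ### Strong law of large numbers along the pulls of an arm -/

section StrongLaw

variable {k : ℕ} {a : ℕ → Fin k} {i : Fin k}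

/-- The weight of round `s` in the martingale attached to arm `i`: the `n`-th pull of the arm
has weight `1 / n`, and rounds in which other arms are pulled have weight `0`. -/
noncomputable def pullWeight (a : ℕ → Fin k) (i : Fin k) (s : ℕ) : ℝ :=
  if a s = i then ((numPulls a i s : ℝ) + 1)⁻¹ else 0

lemma abs_pullWeight_le_one (s : ℕ) : |pullWeight a i s| ≤ 1 := by
  unfold pullWeight
  split_ifs
  · rw [abs_of_pos (by positivity)]
    exact inv_le_one_of_one_le₀ (by simp)
  · simp

lemma sum_pullWeight_sq_le (t : ℕ) : ∑ s ∈ Finset.range t, pullWeight a i s ^ 2 ≤ 2 := by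
  -- the sharper bound `2 - 2 / (N + 1)` propagates along the pulls
  have h : ∑ s ∈ Finset.range t, pullWeight a i s ^ 2 ≤ 2 - 2 / ((numPulls a i t : ℝ) + 1) := by
    induction t with
    | zero => simp
    | succ t ih =>
      rw [Finset.sum_range_succ, numPulls_succ, pullWeight]
      split_ifs
      · push_cast
        set n : ℝ := (numPulls a i t : ℝ)
        have hn : 0 ≤ n := Nat.cast_nonneg _
        have h2 : 2 / (n + 1) - 2 / (n + 1 + 1) - (n + 1)⁻¹ ^ 2
            = n / ((n + 1) ^ 2 * (n + 1 + 1)) := by field_simp; ring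
        have h3 : 0 ≤ n / ((n + 1) ^ 2 * (n + 1 + 1)) := by positivity
        linarith
      · simpa using ih
  have : 0 ≤ 2 / ((numPulls a i t : ℝ) + 1) := by positivity
  linarith

variable {d : ℕ → ℝ}

/-- Summation by parts along the pulls of arm `i`. -/
lemma sum_pulls_eq (t : ℕ) :
    ∑ s ∈ Finset.range t, (if a s = i then d s else 0)
      = numPulls a i t * (∑ s ∈ Finset.range t, pullWeight a i s * d s)
        - ∑ s ∈ Finset.range t,
          (if a s = i then ∑ r ∈ Finset.range s, pullWeight a i r * d r else 0) := by
  induction t with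
  | zero => simp
  | succ t ih =>
    simp only [Finset.sum_range_succ _ t, ih, numPulls_succ]
    split_ifs with h
    · have hN : (numPulls a i t : ℝ) + 1 ≠ 0 := by positivity
      simp only [pullWeight, if_pos h]
      push_cast
      field_simp
      ring
    · simp [pullWeight, h]

lemma cast_numPulls (t : ℕ) :
    (numPulls a i t : ℝ) = ∑ s ∈ Finset.range t, if a s = i then (1 : ℝ) else 0 := by
  simp [numPulls]

lemma exists_abs_sum_pulls_le {l : ℝ}
    (h : Tendsto (fun t => ∑ s ∈ Finset.range t, pullWeight a i s * d s) atTop (𝓝 l)) :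
    ∃ B, 0 ≤ B ∧ ∀ t, |∑ s ∈ Finset.range t, (if a s = i then d s else 0)|
      ≤ B * numPulls a i t := by
  obtain ⟨B, hB⟩ := (Metric.isBounded_range_of_tendsto _ h).exists_norm_le
  simp only [Set.mem_range, forall_exists_index, forall_apply_eq_imp_iff, Real.norm_eq_abs] at hB
  have hB0 : 0 ≤ B := (abs_nonneg _).trans (hB 0)
  refine ⟨2 * B, by positivity, fun t => ?_⟩
  rw [sum_pulls_eq]
  have h1 : |(numPulls a i t : ℝ) * ∑ s ∈ Finset.range t, pullWeight a i s * d s|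
      ≤ numPulls a i t * B := by
    rw [abs_mul, Nat.abs_cast]
    exact mul_le_mul_of_nonneg_left (hB t) (Nat.cast_nonneg _)
  have h2 : |∑ s ∈ Finset.range t,
      (if a s = i then ∑ r ∈ Finset.range s, pullWeight a i r * d r else 0)|
      ≤ numPulls a i t * B := by
    rw [cast_numPulls, Finset.sum_mul]
    refine (Finset.abs_sum_le_sum_abs _ _).trans (Finset.sum_le_sum fun s _ => ?_)
    split_ifs
    · simpa using hB s
    · simp
  calc _ ≤ _ := abs_sub _ _
    _ ≤ _ := add_le_add h1 h2
    _ = _ := by ring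

/-- A form of Kronecker's lemma along the pulls of arm `i`. -/
lemma tendsto_sum_pulls_div {l : ℝ}
    (h : Tendsto (fun t => ∑ s ∈ Finset.range t, pullWeight a i s * d s) atTop (𝓝 l))
    (hN : Tendsto (numPulls a i) atTop atTop) :
    Tendsto (fun t => (∑ s ∈ Finset.range t, (if a s = i then d s else 0)) / numPulls a i t)
      atTop (𝓝 0) := by
  set y : ℕ → ℝ := fun t => ∑ s ∈ Finset.range t, pullWeight a i s * d s with hy
  have hN' : Tendsto (fun t => (numPulls a i t : ℝ)) atTop atTop :=
    tendsto_natCast_atTop_atTop.comp hN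
  have h0 : Tendsto (fun s => y s - l) atTop (𝓝 0) := by simpa using h.sub_const l
  have ho : (fun s => (if a s = i then (1 : ℝ) else 0) * (y s - l))
      =o[atTop] fun s => if a s = i then (1 : ℝ) else 0 := by
    simpa using (Asymptotics.isBigO_refl (fun s => if a s = i then (1 : ℝ) else 0)
      atTop).mul_isLittleO ((Asymptotics.isLittleO_one_iff ℝ).2 h0)
  have hsum := ho.sum_range (fun s => by positivity)
    (by simpa only [← cast_numPulls] using hN')
  simp only [← cast_numPulls] at hsum
  have hlim := (h0.sub hsum.tendsto_div_nhds_zero)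
  rw [sub_zero] at hlim
  refine hlim.congr' ?_
  filter_upwards [hN'.eventually_gt_atTop 0] with t ht
  rw [sum_pulls_eq]
  have e : ∑ s ∈ Finset.range t, (if a s = i then y s else 0)
      = ∑ s ∈ Finset.range t, (if a s = i then (1 : ℝ) else 0) * (y s - l)
        + numPulls a i t * l := by
    rw [cast_numPulls, Finset.sum_mul, ← Finset.sum_add_distrib]
    refine Finset.sum_congr rfl fun s _ => ?_
    split_ifs <;> ring
  simp only [hy] at e ⊢
  rw [e]
  field_simp
  ring

lemma sampleMean_eq_add {x : Fin k → ℕ → ℝ} (m : ℝ) {t : ℕ} (ht : 0 < numPulls a i t) :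
    sampleMean x a i t
      = m + (∑ s ∈ Finset.range t, if a s = i then x i s - m else 0) / numPulls a i t := by
  have ht' : (numPulls a i t : ℝ) ≠ 0 := by exact_mod_cast ht.ne'
  have e : ∑ s ∈ Finset.range t, (if a s = i then x i s else 0)
      = ∑ s ∈ Finset.range t, (if a s = i then x i s - m else 0) + numPulls a i t * m := by
    rw [cast_numPulls, Finset.sum_mul, ← Finset.sum_add_distrib]
    refine Finset.sum_congr rfl fun s _ => ?_
    split_ifs <;> ring
  rw [sampleMean, e]
  field_simp
  ring

lemma exists_abs_sampleMean_le {x : Fin k → ℕ → ℝ} {m l : ℝ}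
    (h : Tendsto (fun t => ∑ s ∈ Finset.range t, pullWeight a i s * (x i s - m)) atTop (𝓝 l)) :
    ∃ B, ∀ t, |sampleMean x a i t| ≤ B := by
  obtain ⟨B, hB0, hB⟩ := exists_abs_sum_pulls_le h
  refine ⟨|m| + B, fun t => ?_⟩
  rcases Nat.eq_zero_or_pos (numPulls a i t) with h0 | h0
  · simp only [sampleMean, h0, Nat.cast_zero, div_zero, abs_zero]
    positivity
  · have h0' : (0 : ℝ) < numPulls a i t := by exact_mod_cast h0
    rw [sampleMean_eq_add m h0]
    refine (abs_add_le _ _).trans (add_le_add le_rfl ?_)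
    rw [abs_div, Nat.abs_cast, div_le_iff₀ h0']
    exact hB t

lemma tendsto_sampleMean {x : Fin k → ℕ → ℝ} {m l : ℝ}
    (h : Tendsto (fun t => ∑ s ∈ Finset.range t, pullWeight a i s * (x i s - m)) atTop (𝓝 l))
    (hN : Tendsto (numPulls a i) atTop atTop) :
    Tendsto (sampleMean x a i) atTop (𝓝 m) := by
  have h1 := (tendsto_sum_pulls_div h hN).const_add m
  rw [add_zero] at h1
  refine h1.congr' ?_
  filter_upwards [hN.eventually_gt_atTop 0] with t ht
  exact (sampleMean_eq_add m ht).symm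

end StrongLaw

section Measurability

variable {Ω : Type*} [m : MeasurableSpace Ω] {k : ℕ} {ℱ : Filtration ℕ m} {I : ℕ → Ω → Fin k}

lemma measurable_numPulls (hI : ∀ t, Measurable[ℱ t] (I t)) (i : Fin k) (t : ℕ) :
    Measurable[ℱ t] fun ω => numPulls (fun s => I s ω) i t := by
  simp only [numPulls, Finset.card_filter]
  refine Finset.measurable_fun_sum _ fun s hs => ?_
  have hs' : Measurable[ℱ t] (I s) :=
    (hI s).mono (ℱ.mono (Finset.mem_range.1 hs).le) le_rfl
  exact Measurable.ite (hs' (measurableSet_singleton i)) measurable_const measurable_const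

lemma measurable_pullWeight (hI : ∀ t, Measurable[ℱ t] (I t)) (i : Fin k) (t : ℕ) :
    Measurable[ℱ t] fun ω => pullWeight (fun s => I s ω) i t := by
  have h1 : Measurable[ℱ t] fun ω => (numPulls (fun s => I s ω) i t : ℝ) :=
    (measurable_from_top (f := fun n : ℕ => (n : ℝ))).comp (measurable_numPulls hI i t)
  exact Measurable.ite (hI t (measurableSet_singleton i)) (h1.add_const 1).inv measurable_const

end Measurability

/-- Almost surely, the rewards of each arm, centred and weighted by the inverse pull counts,
have a convergent sum. -/
lemma ae_exists_tendsto_sum_pullWeight {Ω : Type*} [m : MeasurableSpace Ω] {P : Measure Ω}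
    [IsProbabilityMeasure P] {k : ℕ} {μ σ : Fin k → ℝ} {X : Fin k → ℕ → Ω → ℝ}
    (hX : IsGaussianBandit P μ σ X) {ℱ : Filtration ℕ m} {I : ℕ → Ω → Fin k}
    (hI : IsKGRun P σ X ℱ I) :
    ∀ᵐ ω ∂P, ∀ i, ∃ l, Tendsto (fun t => ∑ s ∈ Finset.range t,
      pullWeight (fun s => I s ω) i s * (X i s ω - μ i)) atTop (𝓝 l) := by
  rw [ae_all_iff]
  intro i
  have hlaw (t) : HasLaw (fun ω => X i t ω - μ i) (gaussianReal 0 (σ i ^ 2).toNNReal) P := by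
    have h := gaussianReal_sub_const ⟨(hX.measurable i t).aemeasurable, hX.law i t⟩ (μ i)
    simpa using h
  have hmeas (t) : Measurable fun ω => X i t ω - μ i := (hX.measurable i t).sub_const _
  refine ae_exists_tendsto_sum_mul (ℱ := ℱ) (d := fun t ω => X i t ω - μ i)
    (w := fun t ω => pullWeight (fun s => I s ω) i t) (V := σ i ^ 2) (C := 2)
    (fun t => (hI.reward_measurable i t).sub_const _)
    (measurable_pullWeight hI.choice_measurable i) (fun t => ?_) (fun t => ?_) (fun t => ?_)
    (fun t => ?_) (fun t ω => abs_pullWeight_le_one t) (fun t ω => sum_pullWeight_sq_le t)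
  · refine indep_of_indep_of_le_left (hI.reward_indep t) (Measurable.comap_le ?_)
    have h1 : Measurable fun v : Fin k → ℝ => v i - μ i := (measurable_pi_apply i).sub_const _
    exact h1.comp (comap_measurable _)
  · have h1 : MemLp id 2 (P.map fun ω => X i t ω - μ i) := by
      rw [(hlaw t).map_eq]; exact memLp_id_gaussianReal' 2 (by simp)
    exact (memLp_map_measure_iff aestronglyMeasurable_id (hmeas t).aemeasurable).1 h1
  · rw [(hlaw t).integral_eq, integral_id_gaussianReal]
  · have h1 := (hlaw t).variance_eq
    rw [variance_id_gaussianReal, variance_of_integral_eq_zero (hmeas t).aemeasurable] at h1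
    · simpa [sq_nonneg] using h1
    · rw [(hlaw t).integral_eq, integral_id_gaussianReal]

/-! ### Gaps between posterior means -/

lemma Knowledge.gap_le {k : ℕ} {S : Knowledge k} {B : ℝ} (hB : ∀ j, |S.mean j| ≤ B)
    (i : Fin k) : S.gap i ≤ 2 * B := by
  have hB0 : 0 ≤ B := (abs_nonneg _).trans (hB i)
  have h : |⨆ j : {j : Fin k // j ≠ i}, S.mean j| ≤ B := by
    rcases isEmpty_or_nonempty {j : Fin k // j ≠ i} with hne | hne
    · simpa using hB0
    · refine abs_le.2 ⟨?_, ciSup_le fun j => (abs_le.1 (hB j)).2⟩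
      exact (abs_le.1 (hB hne.some)).1.trans
        (le_ciSup (f := fun j : {j : Fin k // j ≠ i} => S.mean j) (Set.finite_range _).bddAbove
          hne.some)
  calc S.gap i ≤ _ := abs_sub _ _
    _ ≤ B + B := add_le_add (hB i) h
    _ = 2 * B := by ring

/-- If the mean of arm `b` leads all others by `δ`, every arm has a gap of at least `δ`. -/
lemma Knowledge.le_gap {k : ℕ} {S : Knowledge k} {δ : ℝ} {b i j : Fin k}
    (hb : ∀ l, l ≠ b → δ ≤ S.mean b - S.mean l) (hij : i ≠ j) : δ ≤ S.gap j := by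
  by_cases hj : j = b
  · subst hj
    have : Nonempty {l : Fin k // l ≠ j} := ⟨⟨i, hij⟩⟩
    have h : ⨆ l : {l : Fin k // l ≠ j}, S.mean l ≤ S.mean j - δ :=
      ciSup_le fun l => by linarith [hb l l.2]
    exact le_trans (by linarith) (le_abs_self _)
  · have h : S.mean b ≤ ⨆ l : {l : Fin k // l ≠ j}, S.mean l :=
      le_ciSup (f := fun l : {l : Fin k // l ≠ j} => S.mean l) (Set.finite_range _).bddAbove
        ⟨b, Ne.symm hj⟩
    exact le_trans (by linarith [hb j hj]) (neg_le_abs _)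

/-! ### Every arm is pulled infinitely often -/

lemma le_sqrt_mul_add_one (n : ℕ) : (n : ℝ) ≤ √(n * (n + 1)) :=
  Real.le_sqrt_of_sq_le (by nlinarith [Nat.cast_nonneg (α := ℝ) n])

lemma sqrt_mul_add_one_le (n : ℕ) : √((n : ℝ) * (n + 1)) ≤ 2 * n := by
  rcases Nat.eq_zero_or_pos n with rfl | h
  · simp
  · have h1 : (1 : ℝ) ≤ n := by exact_mod_cast h
    exact Real.sqrt_le_iff.2 ⟨by positivity, by nlinarith⟩

section Deterministic

variable {k : ℕ} {σ : Fin k → ℝ} {x : Fin k → ℕ → ℝ} {a : ℕ → Fin k}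

lemma exists_tendsto_numPulls : ∃ j, Tendsto (numPulls a j) atTop atTop := by
  by_contra! h
  have h' (j) : ∃ l, Tendsto (numPulls a j) atTop (𝓝 l) :=
    (tendsto_atTop_of_monotone (numPulls_mono j)).resolve_left (h j)
  choose l hl using h'
  have h1 : Tendsto (fun t => ∑ j, numPulls a j t) atTop (𝓝 (∑ j, l j)) :=
    tendsto_finsetSum _ fun j _ => hl j
  simp only [sum_numPulls] at h1
  exact not_tendsto_nhds_of_tendsto_atTop tendsto_id _ h1

lemma frequently_pull {j : Fin k} (hj : Tendsto (numPulls a j) atTop atTop) :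
    ∃ᶠ t in atTop, a t = j := by
  intro h
  obtain ⟨T, hT⟩ := eventually_atTop.1 h
  have hconst (t) (ht : T ≤ t) : numPulls a j t = numPulls a j T := by
    induction t, ht using Nat.le_induction with
    | base => rfl
    | succ t ht ih => simp [numPulls_succ, ih, hT t ht]
  obtain ⟨t, h1, h2⟩ := ((hj.eventually_gt_atTop (numPulls a j T)).and
    (eventually_ge_atTop T)).exists
  exact h1.ne' (hconst t h2)

variable (hσ : ∀ i, 0 < σ i)
  (hbdd : ∀ i, ∃ B, ∀ t, |(knowledgeAfter σ x a t).mean i| ≤ B)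
  (hmax : ∀ t i, (knowledgeAfter σ x a t).kgValue σ i ≤ (knowledgeAfter σ x a t).kgValue σ (a t))

include hbdd in
lemma exists_gap_le (i : Fin k) : ∃ D, 0 < D ∧ ∀ t, (knowledgeAfter σ x a t).gap i ≤ D := by
  choose B hB using hbdd
  refine ⟨2 * (∑ j, |B j| + 1), by positivity, fun t => Knowledge.gap_le (fun j => ?_) i⟩
  have h : |B j| ≤ ∑ j, |B j| :=
    Finset.single_le_sum (f := fun j => |B j|) (fun _ _ => abs_nonneg _) (Finset.mem_univ j)
  linarith [hB j t, le_abs_self (B j)]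

include hσ hbdd hmax in
/-- No arm is abandoned: the knowledge gradient of an arm pulled infinitely often tends to zero,
and that of an arm pulled only finitely often stays away from zero. -/
lemma tendsto_numPulls (i : Fin k) : Tendsto (numPulls a i) atTop atTop := by
  by_contra hi
  obtain ⟨l, hl⟩ := (tendsto_atTop_of_monotone (numPulls_mono i)).resolve_left hi
  have hl' : ∀ᶠ t in atTop, numPulls a i t = l := by simpa using hl
  obtain ⟨j, hj⟩ := exists_tendsto_numPulls (a := a)
  have hjR : Tendsto (fun t => (numPulls a j t : ℝ)) atTop atTop :=
    tendsto_natCast_atTop_atTop.comp hj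
  have hupper : ∀ᶠ t in atTop, (knowledgeAfter σ x a t).kgValue σ j
      ≤ ENNReal.ofReal (σ j / numPulls a j t * kgFun 0) := by
    filter_upwards [hj.eventually_gt_atTop 0] with t ht
    have ht' : (0 : ℝ) < numPulls a j t := by exact_mod_cast ht
    rw [kgValue_eq hσ ht rfl]
    refine ENNReal.ofReal_le_ofReal (mul_le_mul ?_ (kgFun_strictMono.monotone ?_)
      (kgFun_nonneg _) (div_pos (hσ j) ht').le)
    · exact div_le_div_of_nonneg_left (hσ j).le ht' (le_sqrt_mul_add_one _)
    · exact neg_nonpos.2 (div_nonneg (abs_nonneg _) (div_nonneg (hσ j).le (Real.sqrt_nonneg _)))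
  have hlower : ∃ c, 0 < c ∧ ∀ᶠ t in atTop,
      ENNReal.ofReal c ≤ (knowledgeAfter σ x a t).kgValue σ i := by
    rcases Nat.eq_zero_or_pos l with rfl | hl0
    · refine ⟨1, one_pos, ?_⟩
      filter_upwards [hl'] with t ht
      simp [kgValue_eq_top ht]
    · obtain ⟨D, -, hD⟩ := exists_gap_le hbdd i
      have hl0' : (0 : ℝ) < l := by exact_mod_cast hl0
      set z := σ i / √((l : ℝ) * (l + 1)) with hz
      have hz0 : 0 < z := div_pos (hσ i) (Real.sqrt_pos.2 (by positivity))
      refine ⟨z * kgFun (-(D / z)), mul_pos hz0 (kgFun_pos _), ?_⟩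
      filter_upwards [hl'] with t ht
      rw [kgValue_eq hσ (ht ▸ hl0) (z := z) (by rw [ht])]
      refine ENNReal.ofReal_le_ofReal (mul_le_mul_of_nonneg_left
        (kgFun_strictMono.monotone (neg_le_neg ?_)) hz0.le)
      exact div_le_div_of_nonneg_right (hD t) hz0.le
  obtain ⟨c, hc, hlower⟩ := hlower
  have hlim : Tendsto (fun t => σ j / numPulls a j t * kgFun 0) atTop (𝓝 0) := by
    simpa using (hjR.const_div_atTop (σ j)).mul_const (kgFun 0)
  obtain ⟨t, hat, h1, h2, h3⟩ := ((frequently_pull hj).and_eventually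
    (hupper.and (hlower.and (hlim.eventually_lt_const hc)))).exists
  have h4 := (h2.trans (hat ▸ hmax t i)).trans h1
  exact (ENNReal.ofReal_lt_ofReal_iff hc).2 h3 |>.not_ge h4

/-! ### Balance of the pull counts -/

include hσ hbdd hmax in
/-- If the gap of arm `j` is bounded below, arm `j` is eventually pulled only while its pull count
is at most a fixed multiple of that of arm `i`. Otherwise `ζ_j ≤ ζ_i`, and as `f` is increasing
`v_i ≤ v_j` forces `Δ_j / ζ_j ≤ Δ_i / ζ_i`, where `1 / ζ` is of the order of the pull count. -/
lemma exists_numPulls_le_of_pull {i j : Fin k} {δ : ℝ} (hδ : 0 < δ)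
    (hgap : ∀ᶠ t in atTop, δ ≤ (knowledgeAfter σ x a t).gap j) :
    ∃ K : ℝ, 0 ≤ K ∧ ∀ᶠ t in atTop, a t = j → (numPulls a j t : ℝ) ≤ K * numPulls a i t := by
  obtain ⟨D, hD0, hD⟩ := exists_gap_le hbdd i
  have hsi := hσ i
  have hsj := hσ j
  refine ⟨max (2 * σ j / σ i) (2 * D * σ j / (δ * σ i)), by positivity, ?_⟩
  filter_upwards [hgap, (tendsto_numPulls hσ hbdd hmax i).eventually_gt_atTop 0,
    (tendsto_numPulls hσ hbdd hmax j).eventually_gt_atTop 0] with t hg hi0 hj0 hat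
  by_contra! hlt
  have hi0' : (0 : ℝ) < numPulls a i t := by exact_mod_cast hi0
  have hj0' : (0 : ℝ) < numPulls a j t := by exact_mod_cast hj0
  have hK1 : 2 * σ j / σ i * numPulls a i t < numPulls a j t :=
    (mul_le_mul_of_nonneg_right (le_max_left _ _) hi0'.le).trans_lt hlt
  have hK2 : 2 * D * σ j / (δ * σ i) * numPulls a i t < numPulls a j t :=
    (mul_le_mul_of_nonneg_right (le_max_right _ _) hi0'.le).trans_lt hlt
  rw [div_mul_eq_mul_div, div_lt_iff₀ (by positivity)] at hK1 hK2
  have hv := hmax t i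
  rw [hat, kgValue_eq hσ hi0 rfl, kgValue_eq hσ hj0 rfl] at hv
  have hri := sqrt_mul_add_one_le (numPulls a i t)
  have hrj := le_sqrt_mul_add_one (numPulls a j t)
  have hri0 : 0 < √((numPulls a i t : ℝ) * (numPulls a i t + 1)) :=
    Real.sqrt_pos.2 (by positivity)
  have hrj0 : 0 < √((numPulls a j t : ℝ) * (numPulls a j t + 1)) :=
    Real.sqrt_pos.2 (by positivity)
  set ri := √((numPulls a i t : ℝ) * (numPulls a i t + 1))
  set rj := √((numPulls a j t : ℝ) * (numPulls a j t + 1))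
  have hzz : σ j / rj ≤ σ i / ri := by
    rw [div_le_div_iff₀ hrj0 hri0]
    nlinarith
  have hzj0 : 0 < σ j / rj := div_pos hsj hrj0
  have hzi0 : 0 < σ i / ri := div_pos hsi hri0
  rw [ENNReal.ofReal_le_ofReal_iff (mul_nonneg hzj0.le (kgFun_nonneg _))] at hv
  have hf := le_of_mul_le_mul_left
    (hv.trans (mul_le_mul_of_nonneg_right hzz (kgFun_nonneg _))) hzi0
  have hq := neg_le_neg_iff.1 (kgFun_strictMono.le_iff_le.1 hf)
  have hq1 : δ / (σ j / rj) ≤ D / (σ i / ri) :=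
    (div_le_div_of_nonneg_right hg hzj0.le).trans
      (hq.trans (div_le_div_of_nonneg_right (hD t) hzi0.le))
  rw [div_div_eq_mul_div, div_div_eq_mul_div, div_le_div_iff₀ hsj hsi] at hq1
  have h1 : δ * numPulls a j t * σ i ≤ δ * rj * σ i := by gcongr
  have h2 : D * ri * σ j ≤ D * (2 * numPulls a i t) * σ j := by gcongr
  nlinarith

include hσ hbdd hmax in
lemma exists_numPulls_le {i j : Fin k} {δ : ℝ} (hδ : 0 < δ)
    (hgap : i ≠ j → ∀ᶠ t in atTop, δ ≤ (knowledgeAfter σ x a t).gap j) :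
    ∃ C : ℝ, 0 < C ∧ ∀ᶠ t in atTop, (numPulls a j t : ℝ) ≤ C * numPulls a i t := by
  rcases eq_or_ne i j with rfl | hij
  · exact ⟨1, one_pos, by simp⟩
  obtain ⟨K, hK0, hK⟩ := exists_numPulls_le_of_pull (i := i) hσ hbdd hmax hδ (hgap hij)
  obtain ⟨T, hT⟩ := eventually_atTop.1 hK
  have key (t) (ht : T ≤ t) :
      (numPulls a j t : ℝ) ≤ K * numPulls a i t + (numPulls a j T + 1) := by
    induction t, ht using Nat.le_induction with
    | base => nlinarith [Nat.cast_nonneg (α := ℝ) (numPulls a i T)]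
    | succ t ht ih =>
      have hmono : (numPulls a i t : ℝ) ≤ numPulls a i (t + 1) := by
        exact_mod_cast numPulls_mono i t.le_succ
      have hmono' := mul_le_mul_of_nonneg_left hmono hK0
      rw [numPulls_succ j]
      split_ifs with h
      · have h1 := hT t ht h
        have h2 : (0 : ℝ) ≤ numPulls a j T := Nat.cast_nonneg _
        push_cast
        linarith
      · push_cast
        linarith
  refine ⟨K + (numPulls a j T + 1), by positivity, ?_⟩
  filter_upwards [eventually_ge_atTop T,
    (tendsto_numPulls hσ hbdd hmax i).eventually_ge_atTop 1] with t ht hi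
  have hi' : (1 : ℝ) ≤ numPulls a i t := by exact_mod_cast hi
  have h2 : (0 : ℝ) ≤ numPulls a j T := Nat.cast_nonneg _
  nlinarith [key t ht]

include hσ hbdd hmax in
/-- All pull counts grow at least linearly, hence eventually exceed `(t / k) ^ (3 / 4)`. -/
lemma eventually_le_numPulls {δ : ℝ} (hδ : 0 < δ)
    (hgap : ∀ i j, i ≠ j → ∀ᶠ t in atTop, δ ≤ (knowledgeAfter σ x a t).gap j) :
    ∀ᶠ t : ℕ in atTop, ∀ i, ((t : ℝ) / k) ^ (3 / 4 : ℝ) ≤ numPulls a i t := by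
  rw [eventually_all]
  intro i
  choose C hC0 hC using fun j => exists_numPulls_le (i := i) (j := j) hσ hbdd hmax hδ (hgap i j)
  have hk : (1 : ℝ) ≤ k := by exact_mod_cast i.pos
  have hpow : Tendsto (fun t : ℕ => (t : ℝ) ^ (1 / 4 : ℝ)) atTop atTop :=
    (tendsto_rpow_atTop (by norm_num)).comp tendsto_natCast_atTop_atTop
  have hCs : 0 < ∑ j, C j := Finset.sum_pos (fun j _ => hC0 j) ⟨i, Finset.mem_univ i⟩
  filter_upwards [eventually_all.2 hC, hpow.eventually_ge_atTop (∑ j, C j),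
    eventually_gt_atTop 0] with t ht hpt ht0
  have ht0' : (0 : ℝ) < t := by exact_mod_cast ht0
  have hlin : (t : ℝ) ≤ (∑ j, C j) * numPulls a i t := by
    have hs : (t : ℝ) = ∑ j, (numPulls a j t : ℝ) := by exact_mod_cast (sum_numPulls t).symm
    rw [hs, Finset.sum_mul]
    exact Finset.sum_le_sum fun j _ => ht j
  have hsplit : (t : ℝ) = (t : ℝ) ^ (1 / 4 : ℝ) * (t : ℝ) ^ (3 / 4 : ℝ) := by
    rw [← Real.rpow_add ht0']; norm_num
  calc ((t : ℝ) / k) ^ (3 / 4 : ℝ) ≤ (t : ℝ) ^ (3 / 4 : ℝ) :=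
        Real.rpow_le_rpow (by positivity) (div_le_self ht0'.le hk) (by norm_num)
    _ ≤ numPulls a i t := by
        refine le_of_mul_le_mul_left (le_trans ?_ hlin) hCs
        calc _ ≤ (t : ℝ) ^ (1 / 4 : ℝ) * (t : ℝ) ^ (3 / 4 : ℝ) := by gcongr
          _ = t := hsplit.symm

end Deterministic

/-! ### A measurable random time and the consistency theorem -/

/-- If events `p t` almost surely hold eventually, they hold from some measurable random time on. -/
lemma exists_measurable_time {Ω : Type*} [MeasurableSpace Ω] {P : Measure Ω}
    {p : ℕ → Ω → Prop} (hm : ∀ t, MeasurableSet {ω | p t ω})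
    (hp : ∀ᵐ ω ∂P, ∀ᶠ t in atTop, p t ω) :
    ∃ T : Ω → ℕ, Measurable T ∧ ∀ᵐ ω ∂P, ∀ t, T ω ≤ t → p t ω := by
  classical
  -- the second alternative makes the search succeed at `0` on the null set of bad outcomes
  let q : Ω → ℕ → Prop := fun ω n => (∀ t, n ≤ t → p t ω) ∨ ∀ N, ¬ ∀ t, N ≤ t → p t ω
  have hq (ω) : ∃ n, q ω n := by
    by_cases h : ∃ n, ∀ t, n ≤ t → p t ω
    · exact h.imp fun n hn => Or.inl hn
    · exact ⟨0, Or.inr (not_exists.1 h)⟩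
  have hall (n : ℕ) : MeasurableSet {ω | ∀ t, n ≤ t → p t ω} := by
    rw [show {ω | ∀ t, n ≤ t → p t ω} = ⋂ t, ⋂ (_ : n ≤ t), {ω | p t ω} by ext; simp]
    exact .iInter fun t => .iInter fun _ => hm t
  have hnone : MeasurableSet {ω | ∀ N, ¬ ∀ t, N ≤ t → p t ω} := by
    rw [show {ω | ∀ N, ¬ ∀ t, N ≤ t → p t ω} = ⋂ N, {ω | ∀ t, N ≤ t → p t ω}ᶜ by ext; simp]
    exact .iInter fun N => (hall N).compl
  refine ⟨fun ω => Nat.find (hq ω), measurable_find hq fun n => (hall n).union hnone, ?_⟩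
  filter_upwards [hp] with ω h
  obtain ⟨n, hn⟩ := eventually_atTop.1 h
  exact (Nat.find_spec (hq ω)).resolve_right fun h' => h' n hn

section Consistency

variable {k : ℕ} {σ : Fin k → ℝ} {x : Fin k → ℕ → ℝ} {a : ℕ → Fin k} (hσ : ∀ i, 0 < σ i)
  (hmax : ∀ t i, (knowledgeAfter σ x a t).kgValue σ i ≤ (knowledgeAfter σ x a t).kgValue σ (a t))
  {μ : Fin k → ℝ}
  (hconv : ∀ i, ∃ l, Tendsto (fun t => ∑ s ∈ Finset.range t, pullWeight a i s * (x i s - μ i))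
    atTop (𝓝 l))

include hσ hconv in
lemma exists_abs_mean_le (i : Fin k) : ∃ B, ∀ t, |(knowledgeAfter σ x a t).mean i| ≤ B := by
  simp_rw [mean_eq_sampleMean hσ]
  exact exists_abs_sampleMean_le (hconv i).choose_spec

include hσ hmax hconv in
lemma tendsto_sampleMean_of_maximizes (i : Fin k) : Tendsto (sampleMean x a i) atTop (𝓝 (μ i)) :=
  tendsto_sampleMean (hconv i).choose_spec
    (tendsto_numPulls hσ (exists_abs_mean_le hσ hconv) hmax i)

include hσ hmax hconv in
/-- The posterior mean of the best arm eventually leads all others by a fixed margin. -/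
lemma exists_eventually_lead {b : Fin k} (hb : ∀ i, i ≠ b → μ i < μ b) :
    ∃ δ > 0, ∀ᶠ t in atTop, ∀ i, i ≠ b →
      δ ≤ (knowledgeAfter σ x a t).mean b - (knowledgeAfter σ x a t).mean i := by
  have hδ : ∀ᶠ δ : ℝ in 𝓝[>] 0, ∀ i, i ≠ b → δ < μ b - μ i := by
    refine eventually_all.2 fun i => ?_
    by_cases hi : i = b
    · simp [hi]
    · filter_upwards [nhdsWithin_le_nhds (eventually_lt_nhds (sub_pos.2 (hb i hi)))] with δ h _
      exact h
  obtain ⟨δ, hδ, hδ0⟩ := (hδ.and self_mem_nhdsWithin).exists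
  refine ⟨δ, hδ0, eventually_all.2 fun i => ?_⟩
  by_cases hi : i = b
  · simp [hi]
  have hlim := (tendsto_sampleMean_of_maximizes hσ hmax hconv b).sub
    (tendsto_sampleMean_of_maximizes hσ hmax hconv i)
  filter_upwards [hlim.eventually_const_lt (hδ i hi)] with t ht _
  simpa only [mean_eq_sampleMean hσ] using ht.le

end Consistency

end KnowledgeGradient

theorem proposition1 {Ω : Type*} [m : MeasurableSpace Ω] (P : Measure Ω) [IsProbabilityMeasure P]
    (k : ℕ) (μ σ : Fin k → ℝ) (hσ : ∀ i, 0 < σ i)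
    (b : Fin k) (hb : ∀ i, i ≠ b → μ i < μ b)
    (X : Fin k → ℕ → Ω → ℝ) (hX : KnowledgeGradient.IsGaussianBandit P μ σ X)
    (ℱ : Filtration ℕ m) (I : ℕ → Ω → Fin k)
    (hI : KnowledgeGradient.IsKGRun P σ X ℱ I) :
    -- every arm is pulled at least `(t / k) ^ (3 / 4)` times, from a random time on
    (∃ T₀ : Ω → ℕ, Measurable T₀ ∧ ∀ᵐ ω ∂P, ∀ t : ℕ, T₀ ω ≤ t → ∀ i,
      ((t : ℝ) / k) ^ (3 / 4 : ℝ) ≤ KnowledgeGradient.numPulls (fun s => I s ω) i t) ∧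
    -- consistency: the estimated means converge to the true means
    (∀ᵐ ω ∂P, ∀ i,
      Tendsto (fun t => KnowledgeGradient.sampleMean (fun j s => X j s ω) (fun s => I s ω) i t)
        atTop (𝓝 (μ i)) ∧
      Tendsto (fun t => (KnowledgeGradient.knowledgeAfter σ (fun j s => X j s ω)
        (fun s => I s ω) t).mean i) atTop (𝓝 (μ i))) ∧
    -- consistency: from some time on, only `b` maximizes the estimated mean
    (∀ᵐ ω ∂P, ∀ᶠ t in atTop, ∀ J : Fin k,
      (∀ i, (KnowledgeGradient.knowledgeAfter σ (fun j s => X j s ω) (fun s => I s ω) t).mean i ≤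
        (KnowledgeGradient.knowledgeAfter σ (fun j s => X j s ω) (fun s => I s ω) t).mean J) →
      J = b) := by
  have hgood := KnowledgeGradient.ae_exists_tendsto_sum_pullWeight hX hI
  refine ⟨KnowledgeGradient.exists_measurable_time (fun t => ?_) ?_, ?_, ?_⟩
  · have hN (i : Fin k) : Measurable fun ω =>
        (KnowledgeGradient.numPulls (fun s => I s ω) i t : ℝ) :=
      (measurable_from_top (f := fun n : ℕ => (n : ℝ))).comp
        ((KnowledgeGradient.measurable_numPulls hI.choice_measurable i t).mono (ℱ.le t) le_rfl)
    rw [Set.ofPred_forall]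
    exact .iInter fun i => measurableSet_le measurable_const (hN i)
  · filter_upwards [hgood] with ω hω
    obtain ⟨δ, hδ, hlead⟩ := KnowledgeGradient.exists_eventually_lead hσ (hI.maximizes · ω) hω hb
    refine KnowledgeGradient.eventually_le_numPulls hσ
      (KnowledgeGradient.exists_abs_mean_le hσ hω) (hI.maximizes · ω) hδ fun i j hij => ?_
    filter_upwards [hlead] with t ht
    exact KnowledgeGradient.Knowledge.le_gap ht hij
  · filter_upwards [hgood] with ω hω i
    have h := KnowledgeGradient.tendsto_sampleMean_of_maximizes hσ (hI.maximizes · ω) hω i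
    refine ⟨h, ?_⟩
    simp_rw [KnowledgeGradient.mean_eq_sampleMean hσ]
    exact h
  · filter_upwards [hgood] with ω hω
    obtain ⟨δ, hδ, hlead⟩ := KnowledgeGradient.exists_eventually_lead hσ (hI.maximizes · ω) hω hb
    filter_upwards [hlead] with t ht J hJ
    by_contra hne
    linarith [ht J hne, hJ b]
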